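/- Let $D=\{z\in\mathbb{C}:|z|<1\}$, let $\mathbb{T}=\partial D$, and let $C_{\mathbb{R}}(\mathbb{T})$ be the Banach space of continuous real functions on $\mathbb{T}$ with the supremum norm, identified with the continuous $2\pi$-periodic functions $\mathbb{R}\to\mathbb{R}$ via $\theta\mapsto e^{i\theta}$. For $u\in C_{\mathbb{R}}(\mathbb{T})$ denote also by $u$ its extension to $\overline{D}$ that is continuous on $\overline{D}$ and harmonic on $D$, and let $\tilde u$ be a harmonic conjugate of it on $D$, i.e. a real function on $D$ such that $u+i\tilde u$ is holomorphic on $D$; it is unique up to an additive constant, whose choice is immaterial below. Let $L$ be the set of all $u\in C_{\mathbb{R}}(\mathbb{T})$ such that (i) $\theta\mapsto u(e^{i\theta})$ is differentiable at no point of $\mathbb{R}$; (ii) $\tilde u$ extends continuously to $\overline{D}$; and (iii) for this extension, $\theta\mapsto\tilde u(e^{i\theta})$ is differentiable at no point of $\mathbb{R}$. Let $Z$ be the set of all $u\in C_{\mathbb{R}}(\mathbb{T})$ with $\sup_{z\in D}|\tilde u(z)|=\infty$. Then $L$ is dense and of first category (meagre) in $C_{\mathbb{R}}(\mathbb{T})$.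 Moreover, $Z$ is a dense (in particular nonempty) $G_\delta$ subset of $C_{\mathbb{R}}(\mathbb{T})$, and $L\cap Z=\emptyset$. -/

import Mathlib

open Complex Metric InnerProductSpace

/-- `h` has a (finite) derivative at no point of the real line. -/
def NowhereDifferentiable (h : ℝ → ℝ) : Prop :=
  ∀ θ : ℝ, ¬ DifferentiableAt ℝ h θ

/-- `U` is the harmonic extension of `u` to the unit disc: harmonic on the open disc, continuous on
the closed disc, with boundary values `u`. Values of `U` outside the closed disc are irrelevant. -/
def IsHarmonicExtension (u : C(Circle, ℝ)) (U : ℂ → ℝ) : Prop :=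
  HarmonicOnNhd U (ball 0 1) ∧ ContinuousOn U (closedBall 0 1) ∧ ∀ ζ : Circle, U ζ = u ζ

/-- `v` is a harmonic conjugate on the open unit disc of (the harmonic extension of) `u`: the
function `U + i v` is holomorphic on the open disc. It is determined by `u` up to an additive
constant on the open disc; its values elsewhere are irrelevant. -/
def IsHarmonicConjugate (u : C(Circle, ℝ)) (v : ℂ → ℝ) : Prop :=
  ∃ U : ℂ → ℝ, IsHarmonicExtension u U ∧
    DifferentiableOn ℂ (fun z => (U z : ℂ) + I * (v z : ℂ)) (ball 0 1)

/-- The continuous real functions `u` on the circle such that `u` is nowhere differentiable, its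
harmonic conjugate `v` has a continuous extension `w` to the closed disc, and the restriction of
`w` to the circle is nowhere differentiable. Functions on the circle are differentiated as
`2π`-periodic functions of the angle `θ`, the point of the circle being `exp (i θ)`.
The choice of the additive constant in `v` does not matter. -/
def conjugateNowhereDifferentiable : Set C(Circle, ℝ) :=
  {u | NowhereDifferentiable (fun θ : ℝ => u (Circle.exp θ)) ∧
    ∃ v : ℂ → ℝ, IsHarmonicConjugate u v ∧
      ∃ w : ℂ → ℝ, ContinuousOn w (closedBall 0 1) ∧ Set.EqOn w v (ball 0 1) ∧
        NowhereDifferentiable (fun θ : ℝ => w (Circle.exp θ))}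

/-- The continuous real functions on the circle whose harmonic conjugate is unbounded on the open
disc. The choice of the additive constant does not matter. -/
def conjugateUnbounded : Set C(Circle, ℝ) :=
  {u | ∃ v : ℂ → ℝ, IsHarmonicConjugate u v ∧ ¬ BddAbove ((fun z => |v z|) '' ball 0 1)}

/-! Both sets are compared through boundedness of the conjugate. For fixed `z` in the disc,
`schwarzIntegral u z` depends continuously on `u`, so an unbounded conjugate is a countable
intersection of open conditions. The complementary set is a linear subspace, and a proper subspace
has empty interior; hence density follows from a single example, the conjugate pair given by `-I *
log (2 - log (1 - z))`. A conjugate that extends continuously to the compact closed disc is bounded,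
which gives disjointness and, with the dense Gδ, meagreness.

For density of `conjugateNowhereDifferentiable`, dilating the Schwarz integral approximates any `u`
by real parts of functions analytic across the circle (`exists_analyticOnNhd_dist_reBoundary_lt`).
Adding a small multiple of `lacunarySeries` makes both boundary functions a smooth function plus a
Weierstrass function (`reBoundary_add_smul_mem`). -/

/-! ### Schwarz and Poisson integrals; the Dirichlet problem on the disc -/

/-- The function on the plane which is constant on rays and restricts to `u` on the circle. -/
noncomputable def radialExtension (u : C(Circle, ℝ)) (z : ℂ) : ℝ :=
  u (Circle.exp (arg z))

lemma radialExtension_coe (u : C(Circle, ℝ)) (ζ : Circle) : radialExtension u ζ = u ζ := by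
  simp [radialExtension]

lemma circleMap_zero_one (θ : ℝ) : circleMap 0 1 θ = Circle.exp θ := by
  simp [circleMap_zero]

lemma radialExtension_circleMap (u : C(Circle, ℝ)) (θ : ℝ) :
    radialExtension u (circleMap 0 1 θ) = u (Circle.exp θ) := by
  rw [circleMap_zero_one, radialExtension_coe]

lemma exists_circle_of_mem_sphere {z : ℂ} (hz : z ∈ sphere (0 : ℂ) 1) : ∃ ζ : Circle, (ζ : ℂ) = z :=
  ⟨⟨z, hz⟩, rfl⟩

lemma Circle.coe_mem_closedBall (ζ : Circle) : (ζ : ℂ) ∈ closedBall (0 : ℂ) 1 := by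
  simp [Circle.norm_coe]

lemma circleIntegrable_radialExtension (u : C(Circle, ℝ)) :
    CircleIntegrable (radialExtension u) 0 1 := by
  unfold CircleIntegrable
  simp_rw [radialExtension_circleMap]
  exact Continuous.intervalIntegrable (by fun_prop) _ _

lemma circleIntegrable_ofReal_radialExtension (u : C(Circle, ℝ)) :
    CircleIntegrable (fun z ↦ (radialExtension u z : ℂ)) 0 1 := by
  unfold CircleIntegrable
  simp_rw [radialExtension_circleMap]
  exact Continuous.intervalIntegrable (by fun_prop) _ _

/-- The Schwarz integral of a real function on the circle: the holomorphic function on the disc whose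
real part is the Poisson integral. -/
noncomputable def schwarzIntegral (u : C(Circle, ℝ)) (w : ℂ) : ℂ :=
  Real.circleAverage (fun ζ ↦ herglotzRieszKernel 0 w ζ • (radialExtension u ζ : ℂ)) 0 1

lemma differentiableOn_schwarzIntegral (u : C(Circle, ℝ)) :
    DifferentiableOn ℂ (schwarzIntegral u) (ball 0 1) :=
  differentiableOn_circleAverage_herglotzRieszKernel_smul
    (circleIntegrable_ofReal_radialExtension u)

lemma analyticOnNhd_schwarzIntegral (u : C(Circle, ℝ)) :
    AnalyticOnNhd ℂ (schwarzIntegral u) (ball 0 1) :=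
  (differentiableOn_schwarzIntegral u).analyticOnNhd isOpen_ball

lemma re_schwarzIntegral (u : C(Circle, ℝ)) {w : ℂ} (hw : w ∈ ball (0 : ℂ) 1) :
    (schwarzIntegral u w).re =
      Real.circleAverage ((re ∘ herglotzRieszKernel 0 w) • radialExtension u) 0 1 :=
  re_circleAverage_herglotzRieszKernel_smul (circleIntegrable_radialExtension u) hw

lemma continuous_schwarzIntegral_apply {w : ℂ} (hw : w ∈ ball (0 : ℂ) 1) :
    Continuous fun u : C(Circle, ℝ) ↦ schwarzIntegral u w := by
  unfold schwarzIntegral Real.circleAverage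
  refine Continuous.const_smul
    (intervalIntegral.continuous_parametric_intervalIntegral_of_continuous' ?_ _ _) _
  simp only [Function.uncurry_def, radialExtension_circleMap]
  have hk : Continuous fun θ : ℝ ↦ herglotzRieszKernel 0 w (circleMap 0 1 θ) := by
    simp only [herglotzRieszKernel_def, sub_zero]
    refine Continuous.div (by fun_prop) (by fun_prop) fun θ ↦ ?_
    exact sub_ne_zero.2 (circleMap_ne_mem_ball hw θ)
  have hk' : Continuous fun p : C(Circle, ℝ) × ℝ ↦ herglotzRieszKernel 0 w (circleMap 0 1 p.2) :=
    hk.comp continuous_snd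
  have hu : Continuous fun p : C(Circle, ℝ) × ℝ ↦ p.1 (Circle.exp p.2) := by fun_prop
  exact hk'.smul (continuous_ofReal.comp hu)

lemma circleIntegrable_re_herglotzRieszKernel_smul {g : ℂ → ℝ} (hg : CircleIntegrable g 0 1)
    {w : ℂ} (hw : w ∈ ball (0 : ℂ) 1) :
    CircleIntegrable ((re ∘ herglotzRieszKernel 0 w) • g) 0 1 :=
  hg.continuousOn_smul
    (continuous_re.comp_continuousOn (continuousOn_herglotzRieszKernel_sphere hw))

lemma re_herglotzRieszKernel_nonneg {w z : ℂ} (hw : w ∈ ball (0 : ℂ) 1)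
    (hz : z ∈ sphere (0 : ℂ) 1) : 0 ≤ (herglotzRieszKernel 0 w z).re := by
  refine le_trans ?_ (le_re_herglotzRieszKernel hz hw)
  have : ‖w‖ < 1 := by simpa using hw
  simp only [sub_zero]
  exact div_nonneg (by linarith) (by positivity)

/-- The Poisson kernel is nonnegative and reproduces `h`. Together with its mirror image, this
comparison yields both uniqueness of the harmonic extension and its continuity at the boundary. -/
lemma re_schwarzIntegral_le {u : C(Circle, ℝ)} {h : ℂ → ℝ} (hh : HarmonicContOnCl h (ball 0 1))
    (hu : ∀ ζ : Circle, u ζ ≤ h ζ) {w : ℂ} (hw : w ∈ ball (0 : ℂ) 1) :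
    (schwarzIntegral u w).re ≤ h w := by
  rw [re_schwarzIntegral u hw, ← hh.circleAverage_re_herglotzRieszKernel_smul hw]
  refine Real.circleAverage_mono
    (circleIntegrable_re_herglotzRieszKernel_smul (circleIntegrable_radialExtension u) hw)
    (circleIntegrable_re_herglotzRieszKernel_smul ?_ hw) fun z hz ↦ ?_
  · exact (hh.continuousOn_ball.mono sphere_subset_closedBall).circleIntegrable zero_le_one
  · rw [abs_one] at hz
    obtain ⟨ζ, rfl⟩ := exists_circle_of_mem_sphere hz
    simp only [Pi.smul_apply', Function.comp_apply, smul_eq_mul, radialExtension_coe]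
    exact mul_le_mul_of_nonneg_left (hu ζ) (re_herglotzRieszKernel_nonneg hw hz)

lemma le_re_schwarzIntegral {u : C(Circle, ℝ)} {h : ℂ → ℝ} (hh : HarmonicContOnCl h (ball 0 1))
    (hu : ∀ ζ : Circle, h ζ ≤ u ζ) {w : ℂ} (hw : w ∈ ball (0 : ℂ) 1) :
    h w ≤ (schwarzIntegral u w).re := by
  rw [re_schwarzIntegral u hw, ← hh.circleAverage_re_herglotzRieszKernel_smul hw]
  refine Real.circleAverage_mono (circleIntegrable_re_herglotzRieszKernel_smul ?_ hw)
    (circleIntegrable_re_herglotzRieszKernel_smul (circleIntegrable_radialExtension u) hw)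
    fun z hz ↦ ?_
  · exact (hh.continuousOn_ball.mono sphere_subset_closedBall).circleIntegrable zero_le_one
  · rw [abs_one] at hz
    obtain ⟨ζ, rfl⟩ := exists_circle_of_mem_sphere hz
    simp only [Pi.smul_apply', Function.comp_apply, smul_eq_mul, radialExtension_coe]
    exact mul_le_mul_of_nonneg_left (hu ζ) (re_herglotzRieszKernel_nonneg hw hz)

lemma IsHarmonicExtension.harmonicContOnCl {u : C(Circle, ℝ)} {U : ℂ → ℝ}
    (h : IsHarmonicExtension u U) : HarmonicContOnCl U (ball 0 1) :=
  HarmonicContOnCl.mk_ball h.1 h.2.1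

lemma IsHarmonicExtension.eq_re_schwarzIntegral {u : C(Circle, ℝ)} {U : ℂ → ℝ}
    (h : IsHarmonicExtension u U) {w : ℂ} (hw : w ∈ ball (0 : ℂ) 1) :
    U w = (schwarzIntegral u w).re :=
  le_antisymm (le_re_schwarzIntegral h.harmonicContOnCl (fun ζ ↦ (h.2.2 ζ).le) hw)
    (re_schwarzIntegral_le h.harmonicContOnCl (fun ζ ↦ (h.2.2 ζ).ge) hw)

open Classical in
/-- The Poisson integral on the open disc, glued with the boundary function. -/
noncomputable def poissonExtension (u : C(Circle, ℝ)) (z : ℂ) : ℝ :=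
  if z ∈ ball (0 : ℂ) 1 then (schwarzIntegral u z).re else radialExtension u z

lemma poissonExtension_of_mem (u : C(Circle, ℝ)) {z : ℂ} (hz : z ∈ ball (0 : ℂ) 1) :
    poissonExtension u z = (schwarzIntegral u z).re := if_pos hz

lemma poissonExtension_coe (u : C(Circle, ℝ)) (ζ : Circle) : poissonExtension u ζ = u ζ := by
  rw [poissonExtension, if_neg (by simp [Circle.norm_coe]), radialExtension_coe]

lemma poissonExtension_le {u : C(Circle, ℝ)} {h : ℂ → ℝ} (hh : HarmonicContOnCl h (ball 0 1))
    (hu : ∀ ζ : Circle, u ζ ≤ h ζ) {w : ℂ} (hw : w ∈ closedBall (0 : ℂ) 1) :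
    poissonExtension u w ≤ h w := by
  rcases (ball_union_sphere (x := (0 : ℂ)) (ε := 1)).symm ▸ hw with hw | hw
  · rw [poissonExtension_of_mem u hw]
    exact re_schwarzIntegral_le hh hu hw
  · obtain ⟨ζ, rfl⟩ := exists_circle_of_mem_sphere hw
    rw [poissonExtension_coe]
    exact hu ζ

lemma le_poissonExtension {u : C(Circle, ℝ)} {h : ℂ → ℝ} (hh : HarmonicContOnCl h (ball 0 1))
    (hu : ∀ ζ : Circle, h ζ ≤ u ζ) {w : ℂ} (hw : w ∈ closedBall (0 : ℂ) 1) :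
    h w ≤ poissonExtension u w := by
  rcases (ball_union_sphere (x := (0 : ℂ)) (ε := 1)).symm ▸ hw with hw | hw
  · rw [poissonExtension_of_mem u hw]
    exact le_re_schwarzIntegral hh hu hw
  · obtain ⟨ζ, rfl⟩ := exists_circle_of_mem_sphere hw
    rw [poissonExtension_coe]
    exact hu ζ

lemma sq_norm_circle_sub (ζ ξ : Circle) :
    ‖(ζ : ℂ) - ξ‖ ^ 2 = 2 - 2 * ((ζ : ℂ) * (starRingEnd ℂ) ξ).re := by
  rw [← normSq_eq_norm_sq, normSq_sub]
  simp only [normSq_eq_norm_sq, Circle.norm_coe]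
  ring

/-- With `c` the conjugate of a point `ξ` of the circle, `2 - 2 * (z * c).re` equals `‖z - ξ‖ ^ 2`
on the circle, so these functions serve as harmonic barriers at `ξ`. -/
lemma harmonicContOnCl_affine (a b : ℝ) (c : ℂ) :
    HarmonicContOnCl (fun z : ℂ ↦ a + b * (2 - 2 * (z * c).re)) (ball 0 1) := by
  refine HarmonicOnNhd.harmonicContOnCl fun z _ ↦ ?_
  have : AnalyticAt ℂ (fun z : ℂ ↦ a + b * (2 - 2 * (z * c))) z := by fun_prop
  convert this.harmonicAt_re using 2
  simp

/-- A quadratic majorant of the oscillation of a continuous function on the circle. -/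
lemma exists_abs_sub_le_add_mul_sq (u : C(Circle, ℝ)) (ξ : Circle) {ε : ℝ} (hε : 0 < ε) :
    ∃ C : ℝ, ∀ ζ : Circle, |u ζ - u ξ| ≤ ε + C * ‖(ζ : ℂ) - ξ‖ ^ 2 := by
  obtain ⟨δ, hδ, h⟩ := Metric.continuousAt_iff.1 u.continuous.continuousAt ε hε
  -- At distance at least `δ` from `ξ`, the quadratic term alone dominates the trivial bound `2 *
  -- ‖u‖`.
  refine ⟨2 * ‖u‖ / δ ^ 2, fun ζ ↦ ?_⟩
  by_cases hd : dist ζ ξ < δ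
  · have := h hd
    rw [Real.dist_eq] at this
    have : 0 ≤ 2 * ‖u‖ / δ ^ 2 * ‖(ζ : ℂ) - ξ‖ ^ 2 := by positivity
    linarith
  · have hd' : δ ≤ ‖(ζ : ℂ) - ξ‖ := by
      rw [← dist_eq_norm]
      exact not_lt.1 hd
    have h1 : |u ζ - u ξ| ≤ 2 * ‖u‖ := by
      have h1 := u.norm_coe_le_norm ζ
      have h2 := u.norm_coe_le_norm ξ
      rw [← Real.norm_eq_abs]
      linarith [norm_sub_le (u ζ) (u ξ)]
    have h2 : 2 * ‖u‖ * 1 ≤ 2 * ‖u‖ / δ ^ 2 * ‖(ζ : ℂ) - ξ‖ ^ 2 := by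
      rw [div_mul_eq_mul_div, mul_div_assoc]
      gcongr
      rw [one_le_div (by positivity)]
      gcongr
    linarith

open Topology Filter in
lemma continuousOn_poissonExtension (u : C(Circle, ℝ)) :
    ContinuousOn (poissonExtension u) (closedBall 0 1) := by
  intro w hw
  rcases (ball_union_sphere (x := (0 : ℂ)) (ε := 1)).symm ▸ hw with hw | hw
  · refine ContinuousAt.continuousWithinAt ?_
    have h : ContinuousAt (fun z ↦ (schwarzIntegral u z).re) w :=
      continuous_re.continuousAt.comp (analyticOnNhd_schwarzIntegral u w hw).continuousAt
    refine h.congr ?_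
    filter_upwards [isOpen_ball.mem_nhds hw] with z hz using (poissonExtension_of_mem u hz).symm
  · obtain ⟨ξ, rfl⟩ := exists_circle_of_mem_sphere hw
    rw [ContinuousWithinAt, poissonExtension_coe, Metric.tendsto_nhds]
    intro ε hε
    -- The barriers `u ξ ± (ε / 2 + C * ‖ζ - ξ‖ ^ 2)` enclose `u` on the circle; their harmonic
    -- extensions enclose the Poisson integral inside.
    obtain ⟨C, hC⟩ := exists_abs_sub_le_add_mul_sq u ξ (half_pos hε)
    have hlim : Tendsto (fun z : ℂ ↦ C * (2 - 2 * (z * (starRingEnd ℂ) ξ).re))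
        (𝓝[closedBall 0 1] ξ) (𝓝 0) := by
      have : Continuous fun z : ℂ ↦ C * (2 - 2 * (z * (starRingEnd ℂ) ξ).re) := by fun_prop
      refine (this.tendsto' (ξ : ℂ) 0 ?_).mono_left nhdsWithin_le_nhds
      rw [← sq_norm_circle_sub]
      simp
    filter_upwards [hlim.eventually (gt_mem_nhds (half_pos hε)), self_mem_nhdsWithin] with z hz hzb
    have hup := poissonExtension_le (u := u)
      (harmonicContOnCl_affine (u ξ + ε / 2) C ((starRingEnd ℂ) ξ)) (fun ζ ↦ by
        rw [← sq_norm_circle_sub]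
        linarith [(abs_le.1 (hC ζ)).2]) hzb
    have hlo := le_poissonExtension (u := u)
      (harmonicContOnCl_affine (u ξ - ε / 2) (-C) ((starRingEnd ℂ) ξ)) (fun ζ ↦ by
        rw [← sq_norm_circle_sub]
        linarith [(abs_le.1 (hC ζ)).1]) hzb
    rw [Real.dist_eq, abs_lt]
    constructor <;> linarith

lemma isHarmonicExtension_poissonExtension (u : C(Circle, ℝ)) :
    IsHarmonicExtension u (poissonExtension u) := by
  refine ⟨fun z hz ↦ ?_, continuousOn_poissonExtension u, poissonExtension_coe u⟩
  refine (harmonicAt_congr_nhds ?_).2 (analyticOnNhd_schwarzIntegral u z hz).harmonicAt_re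
  filter_upwards [isOpen_ball.mem_nhds hz] with y hy using poissonExtension_of_mem u hy

lemma isHarmonicConjugate_im_schwarzIntegral (u : C(Circle, ℝ)) :
    IsHarmonicConjugate u fun z ↦ (schwarzIntegral u z).im := by
  refine ⟨_, isHarmonicExtension_poissonExtension u,
    (differentiableOn_schwarzIntegral u).congr fun z hz ↦ ?_⟩
  rw [poissonExtension_of_mem u hz, mul_comm, re_add_im]

/-- Holomorphic functions on the connected disc with equal real parts differ by an imaginary
constant. -/
lemma IsHarmonicConjugate.exists_eq_im_schwarzIntegral_add {u : C(Circle, ℝ)} {v : ℂ → ℝ}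
    (h : IsHarmonicConjugate u v) :
    ∃ c : ℝ, ∀ z ∈ ball (0 : ℂ) 1, v z = (schwarzIntegral u z).im + c := by
  obtain ⟨U, hU, hF⟩ := h
  have hd := (hF.sub (differentiableOn_schwarzIntegral u)).analyticOnNhd isOpen_ball
  obtain ⟨c, hc⟩ := hd.eq_re_add_const_mul_I_of_re_eq_const (c₀ := 0) (fun z hz ↦ by
    simp [hU.eq_re_schwarzIntegral hz]) isOpen_ball
      ((convex_ball _ _).isConnected (nonempty_ball.2 one_pos))
  refine ⟨c, fun z hz ↦ ?_⟩
  have := congrArg im (hc z hz)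
  simp at this
  linarith

/-! ### Linearity of conjugation; Baire category of `conjugateUnbounded` -/

lemma IsHarmonicExtension.add {u₁ u₂ : C(Circle, ℝ)} {U₁ U₂ : ℂ → ℝ}
    (h₁ : IsHarmonicExtension u₁ U₁) (h₂ : IsHarmonicExtension u₂ U₂) :
    IsHarmonicExtension (u₁ + u₂) (U₁ + U₂) :=
  ⟨h₁.1.add h₂.1, h₁.2.1.add h₂.2.1, fun ζ ↦ by simp [h₁.2.2, h₂.2.2]⟩

lemma IsHarmonicExtension.smul {u : C(Circle, ℝ)} {U : ℂ → ℝ}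
    (h : IsHarmonicExtension u U) (c : ℝ) : IsHarmonicExtension (c • u) (c • U) :=
  ⟨h.1.const_smul, h.2.1.const_smul c, fun ζ ↦ by simp [h.2.2]⟩

lemma IsHarmonicConjugate.add {u₁ u₂ : C(Circle, ℝ)} {v₁ v₂ : ℂ → ℝ}
    (h₁ : IsHarmonicConjugate u₁ v₁) (h₂ : IsHarmonicConjugate u₂ v₂) :
    IsHarmonicConjugate (u₁ + u₂) (v₁ + v₂) := by
  obtain ⟨U₁, hU₁, hF₁⟩ := h₁
  obtain ⟨U₂, hU₂, hF₂⟩ := h₂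
  refine ⟨_, hU₁.add hU₂, (hF₁.add hF₂).congr fun z _ ↦ ?_⟩
  simp only [Pi.add_apply, ofReal_add]
  ring

lemma IsHarmonicConjugate.smul {u : C(Circle, ℝ)} {v : ℂ → ℝ}
    (h : IsHarmonicConjugate u v) (c : ℝ) : IsHarmonicConjugate (c • u) (c • v) := by
  obtain ⟨U, hU, hF⟩ := h
  refine ⟨_, hU.smul c, (hF.const_smul (c : ℂ)).congr fun z _ ↦ ?_⟩
  simp only [Pi.smul_apply, smul_eq_mul, ofReal_mul]
  ring

lemma IsHarmonicConjugate.bddAbove_iff {u : C(Circle, ℝ)} {v : ℂ → ℝ}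
    (h : IsHarmonicConjugate u v) :
    BddAbove ((fun z ↦ |v z|) '' ball 0 1) ↔
      BddAbove ((fun z ↦ |(schwarzIntegral u z).im|) '' ball 0 1) := by
  obtain ⟨c, hc⟩ := h.exists_eq_im_schwarzIntegral_add
  simp only [bddAbove_def, Set.forall_mem_image]
  constructor
  · rintro ⟨M, hM⟩
    refine ⟨M + |c|, fun z hz ↦ ?_⟩
    have := hM hz
    rw [hc z hz] at this
    linarith [abs_sub_abs_le_abs_sub (schwarzIntegral u z).im (-c), abs_neg c,
      sub_neg_eq_add (schwarzIntegral u z).im c ▸ this]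
  · rintro ⟨M, hM⟩
    refine ⟨M + |c|, fun z hz ↦ ?_⟩
    rw [hc z hz]
    linarith [abs_add_le (schwarzIntegral u z).im c, hM hz]

lemma mem_conjugateUnbounded_iff {u : C(Circle, ℝ)} {v : ℂ → ℝ} (h : IsHarmonicConjugate u v) :
    u ∈ conjugateUnbounded ↔ ¬ BddAbove ((fun z ↦ |v z|) '' ball 0 1) := by
  refine ⟨?_, fun hv ↦ ⟨v, h, hv⟩⟩
  rintro ⟨v', hv', hb⟩
  rwa [h.bddAbove_iff, ← hv'.bddAbove_iff]

lemma isGδ_conjugateUnbounded : IsGδ conjugateUnbounded := by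
  have : conjugateUnbounded = ⋂ n : ℕ, ⋃ z ∈ ball (0 : ℂ) 1,
      {u : C(Circle, ℝ) | (n : ℝ) < |(schwarzIntegral u z).im|} := by
    ext u
    rw [mem_conjugateUnbounded_iff (isHarmonicConjugate_im_schwarzIntegral u), not_bddAbove_iff]
    simp only [Set.exists_mem_image, Set.mem_iInter, Set.mem_iUnion, Set.mem_ofPred_eq, exists_prop]
    refine ⟨fun h n ↦ h n, fun h M ↦ ?_⟩
    obtain ⟨n, hn⟩ := exists_nat_ge M
    obtain ⟨z, hz, hlt⟩ := h n
    exact ⟨z, hz, hn.trans_lt hlt⟩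
  rw [this]
  refine IsGδ.iInter_of_isOpen fun n ↦ isOpen_biUnion fun z hz ↦ ?_
  exact isOpen_lt continuous_const (continuous_im.comp (continuous_schwarzIntegral_apply hz)).abs

/-- The continuous functions on the circle with bounded harmonic conjugate. -/
def boundedConjugate : Submodule ℝ C(Circle, ℝ) where
  carrier := conjugateUnboundedᶜ
  zero_mem' := by
    have h : IsHarmonicConjugate 0 0 := by
      simpa using (isHarmonicConjugate_im_schwarzIntegral 0).smul 0
    rw [Set.mem_compl_iff, mem_conjugateUnbounded_iff h, not_not]
    exact ⟨0, by simp⟩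
  add_mem' {u₁ u₂} hu₁ hu₂ := by
    have h₁ := isHarmonicConjugate_im_schwarzIntegral u₁
    have h₂ := isHarmonicConjugate_im_schwarzIntegral u₂
    rw [Set.mem_compl_iff, mem_conjugateUnbounded_iff h₁, not_not] at hu₁
    rw [Set.mem_compl_iff, mem_conjugateUnbounded_iff h₂, not_not] at hu₂
    rw [Set.mem_compl_iff, mem_conjugateUnbounded_iff (h₁.add h₂), not_not]
    simp only [bddAbove_def, Set.forall_mem_image] at hu₁ hu₂ ⊢
    obtain ⟨M₁, hM₁⟩ := hu₁
    obtain ⟨M₂, hM₂⟩ := hu₂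
    exact ⟨M₁ + M₂, fun z hz ↦ (abs_add_le _ _).trans (add_le_add (hM₁ hz) (hM₂ hz))⟩
  smul_mem' c u hu := by
    have h := isHarmonicConjugate_im_schwarzIntegral u
    rw [Set.mem_compl_iff, mem_conjugateUnbounded_iff h, not_not] at hu
    rw [Set.mem_compl_iff, mem_conjugateUnbounded_iff (h.smul c), not_not]
    simp only [bddAbove_def, Set.forall_mem_image] at hu ⊢
    obtain ⟨M, hM⟩ := hu
    refine ⟨|c| * M, fun z hz ↦ ?_⟩
    simp only [Pi.smul_apply, smul_eq_mul, abs_mul]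
    exact mul_le_mul_of_nonneg_left (hM hz) (abs_nonneg c)

lemma coe_boundedConjugate : (boundedConjugate : Set C(Circle, ℝ)) = conjugateUnboundedᶜ := rfl

lemma dense_conjugateUnbounded (h : conjugateUnbounded.Nonempty) : Dense conjugateUnbounded := by
  rw [← compl_compl conjugateUnbounded, ← interior_eq_empty_iff_dense_compl,
    ← coe_boundedConjugate, ← Set.not_nonempty_iff_eq_empty]
  intro hint
  obtain ⟨u, hu⟩ := h
  have : u ∈ (boundedConjugate : Set C(Circle, ℝ)) := by
    rw [boundedConjugate.eq_top_of_nonempty_interior' hint]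
    trivial
  exact this hu

lemma disjoint_conjugateNowhereDifferentiable_conjugateUnbounded :
    Disjoint conjugateNowhereDifferentiable conjugateUnbounded := by
  rw [Set.disjoint_left]
  rintro u ⟨-, v, hv, w, hw, hwv, -⟩
  rw [mem_conjugateUnbounded_iff hv, not_not]
  refine ((isCompact_closedBall (0 : ℂ) 1).bddAbove_image hw.abs).mono ?_
  rintro _ ⟨z, hz, rfl⟩
  exact ⟨z, ball_subset_closedBall hz, by simp [hwv hz]⟩

/-! ### A continuous function with unbounded conjugate -/

/-- The image of the closed unit disc under `z ↦ 2 - log (1 - z)` lies in the right half-plane. -/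
lemma re_two_sub_log_pos {z : ℂ} (hz : z ∈ closedBall (0 : ℂ) 1) :
    0 < (2 - log (1 - z)).re := by
  have h2 : ‖1 - z‖ ≤ 2 := by
    have := norm_sub_le 1 z
    rw [mem_closedBall_zero_iff] at hz
    rw [norm_one] at this
    linarith
  simp only [sub_re, re_ofNat, log_re]
  rcases eq_or_ne (1 - z) 0 with h | h
  · simp [h]
  · have := Real.log_le_sub_one_of_pos (norm_pos_iff.2 h)
    linarith

lemma one_sub_mem_slitPlane {z : ℂ} (hz : z ∈ closedBall (0 : ℂ) 1) (h1 : z ≠ 1) :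
    1 - z ∈ slitPlane := by
  rw [mem_closedBall_zero_iff] at hz
  have hn : normSq z ≤ 1 := by
    rw [normSq_eq_norm_sq]
    nlinarith [norm_nonneg z]
  rw [normSq_apply] at hn
  left
  simp only [sub_re, one_re, sub_pos]
  by_contra! hre
  have hre' : z.re = 1 := by nlinarith [mul_self_nonneg z.im]
  have him : z.im = 0 := by
    rw [hre'] at hn
    nlinarith
  exact h1 (Complex.ext hre' him)

open Filter Topology in
lemma tendsto_re_two_sub_log :
    Tendsto (fun z : ℂ ↦ (2 - log (1 - z)).re) (𝓝[≠] 1) atTop := by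
  have h : Tendsto (fun z : ℂ ↦ ‖1 - z‖) (𝓝[≠] 1) (𝓝[>] 0) := by
    refine tendsto_nhdsWithin_iff.2 ⟨?_, ?_⟩
    · have : Continuous fun z : ℂ ↦ ‖1 - z‖ := by fun_prop
      exact (this.tendsto' 1 0 (by simp)).mono_left nhdsWithin_le_nhds
    · filter_upwards [self_mem_nhdsWithin] with z hz
      exact norm_pos_iff.2 (sub_ne_zero.2 (Ne.symm hz))
  have h2 := tendsto_atTop_add_const_left _ 2
    (tendsto_neg_atBot_atTop.comp (Real.tendsto_log_nhdsGT_zero.comp h))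
  refine h2.congr fun z ↦ ?_
  simp [log_re, sub_eq_add_neg]

-- Near `1` the real part of `2 - log (1 - z)` tends to infinity while the imaginary part stays
-- within `π`, so the argument tends to `0`.
open Filter Topology in
lemma continuousOn_arg_two_sub_log :
    ContinuousOn (fun z ↦ arg (2 - log (1 - z))) (closedBall 0 1) := by
  intro z hz
  rcases eq_or_ne z 1 with rfl | h1
  · rw [← continuousWithinAt_sdiff_self, ContinuousWithinAt]
    -- The convention `log 0 = 0` gives the value `arg 2 = 0` at `z = 1`, which is the correct
    -- limit.
    have h0 : arg (2 - log (1 - 1)) = Real.arcsin 0 := by simp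
    rw [h0]
    have hle : 𝓝[closedBall (0 : ℂ) 1 \ {1}] 1 ≤ 𝓝[≠] 1 := nhdsWithin_mono _ fun z hz ↦ hz.2
    have hquot : Tendsto (fun z : ℂ ↦ (2 - log (1 - z)).im / ‖2 - log (1 - z)‖)
        (𝓝[closedBall (0 : ℂ) 1 \ {1}] 1) (𝓝 0) := by
      refine squeeze_zero_norm' ?_ ((tendsto_re_two_sub_log.const_div_atTop Real.pi).mono_left hle)
      filter_upwards [self_mem_nhdsWithin] with z hz
      have hpos := re_two_sub_log_pos hz.1
      rw [norm_div, norm_norm]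
      gcongr
      · simp only [sub_im, log_im, Real.norm_eq_abs, im_ofNat, zero_sub, abs_neg]
        exact abs_arg_le_pi _
      · exact re_le_norm _
    refine ((Real.continuous_arcsin.tendsto 0).comp hquot).congr' ?_
    filter_upwards [self_mem_nhdsWithin] with z hz
    exact (arg_of_re_nonneg (re_two_sub_log_pos hz.1).le).symm
  · refine ContinuousAt.continuousWithinAt ?_
    have hc : ContinuousAt (fun z ↦ 2 - log (1 - z)) z :=
      continuousAt_const.sub (ContinuousAt.clog (by fun_prop) (one_sub_mem_slitPlane hz h1))
    exact ContinuousAt.comp (f := fun z ↦ 2 - log (1 - z))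
      (continuousAt_arg (Or.inl (re_two_sub_log_pos hz))) hc

lemma differentiableOn_log_two_sub_log :
    DifferentiableOn ℂ (fun z ↦ log (2 - log (1 - z))) (ball 0 1) := by
  have h1 : ∀ z ∈ ball (0 : ℂ) 1, 1 - z ∈ slitPlane := fun z hz ↦
    one_sub_mem_slitPlane (ball_subset_closedBall hz) (by rintro rfl; simp at hz)
  refine DifferentiableOn.clog ?_ fun z hz ↦ Or.inl (re_two_sub_log_pos (ball_subset_closedBall hz))
  exact (differentiableOn_const _).sub (DifferentiableOn.clog (by fun_prop) h1)

lemma nonempty_conjugateUnbounded : conjugateUnbounded.Nonempty := by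
  let u : C(Circle, ℝ) := ⟨fun ζ ↦ arg (2 - log (1 - ζ)),
    continuousOn_arg_two_sub_log.comp_continuous (by fun_prop) Circle.coe_mem_closedBall⟩
  have hF := differentiableOn_log_two_sub_log
  have hU : IsHarmonicExtension u fun z ↦ arg (2 - log (1 - z)) := by
    refine ⟨fun z hz ↦ ?_, continuousOn_arg_two_sub_log, fun ζ ↦ rfl⟩
    simpa only [log_im] using (hF.analyticOnNhd isOpen_ball z hz).harmonicAt_im
  refine ⟨u, fun z ↦ -Real.log ‖2 - log (1 - z)‖, ⟨_, hU, ?_⟩, ?_⟩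
  · refine (hF.const_mul (-I)).congr fun z _ ↦ ?_
    apply Complex.ext <;> simp [log_re, log_im]
  · rw [not_bddAbove_iff]
    intro M
    have hM : Real.exp 1 ≤ Real.exp (|M| + 1) := Real.exp_le_exp.2 (by linarith [abs_nonneg M])
    have he : 2 < Real.exp 1 := by linarith [Real.exp_one_gt_d9]
    -- Chosen so that `2 - log t = exp (|M| + 1)`: at `1 - t` the conjugate has absolute value `|M|
    -- + 1`. The bound `2 < exp 1` ensures `t < 1`.
    set t := Real.exp (2 - Real.exp (|M| + 1)) with ht
    have ht0 : 0 < t := Real.exp_pos _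
    have ht1 : t < 1 := by rw [ht, Real.exp_lt_one_iff]; linarith
    refine ⟨_, ⟨((1 - t : ℝ) : ℂ), ?_, rfl⟩, ?_⟩
    · rw [mem_ball_zero_iff, norm_real, Real.norm_eq_abs, abs_lt]
      constructor <;> linarith
    · have h : (2 : ℂ) - log (1 - ((1 - t : ℝ) : ℂ)) = (Real.exp (|M| + 1) : ℝ) := by
        have : (1 : ℂ) - ((1 - t : ℝ) : ℂ) = (t : ℝ) := by push_cast; ring
        rw [this, ← ofReal_log ht0.le, ht, Real.log_exp]
        push_cast
        ring
      simp only [h, norm_real, Real.norm_eq_abs, Real.abs_exp, Real.log_exp, abs_neg]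
      rw [abs_of_nonneg (by positivity)]
      linarith [le_abs_self M]

/-! ### Weierstrass functions -/

open Real in
lemma summable_half_pow_mul_cos (x : ℝ) :
    Summable fun n : ℕ ↦ (1 / 2 : ℝ) ^ n * Real.cos (5 ^ n * x) := by
  refine Summable.of_norm_bounded summable_geometric_two fun n ↦ ?_
  rw [norm_mul, norm_pow]
  simpa [abs_of_pos] using Real.abs_cos_le_one (5 ^ n * x)

open Real in
/-- The cosine lacunary series varies by at least `c / 2 ^ m` between consecutive points of the
lattice `5 ^ (-m) π ℤ`. -/
lemma le_abs_tsum_cos_sub (m : ℕ) (k : ℤ) :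
    (4 - 2 * π / 3) * (1 / 2) ^ m ≤
      |(∑' n : ℕ, (1 / 2 : ℝ) ^ n * Real.cos (5 ^ n * ((k + 1) * π / 5 ^ m))) -
        ∑' n : ℕ, (1 / 2 : ℝ) ^ n * Real.cos (5 ^ n * (k * π / 5 ^ m))| := by
  rw [← (summable_half_pow_mul_cos _).tsum_sub (summable_half_pow_mul_cos _),
    ← ((summable_half_pow_mul_cos _).sub (summable_half_pow_mul_cos _)).sum_add_tsum_nat_add m]
  simp only [← mul_sub]
  set s : ℝ := Real.cos ((k + 1) * π) - Real.cos (k * π) with hs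
  have hs2 : |s| = 2 := by
    have h : Real.cos ((k + 1) * π) = -Real.cos (k * π) := by rw [add_mul, one_mul, Real.cos_add_pi]
    rw [hs, h, show -Real.cos (k * π) - Real.cos (k * π) = -(2 * Real.cos (k * π)) by ring, abs_neg, abs_mul,
      Real.abs_cos_int_mul_pi]
    simp
  -- Since `5 ^ n` is odd, all terms of index at least `m` change by a multiple of the same `s = ±2`
  -- and reinforce each other.
  have htail : ∑' n : ℕ, (1 / 2 : ℝ) ^ (n + m) * (Real.cos (5 ^ (n + m) * ((k + 1) * π / 5 ^ m)) -
      Real.cos (5 ^ (n + m) * (k * π / 5 ^ m))) = 2 * (1 / 2) ^ m * s := by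
    have hper (n : ℕ) (j : ℤ) : Real.cos (5 ^ (n + m) * (j * π / 5 ^ m)) = Real.cos (j * π) := by
      have hodd : Odd ((5 : ℤ) ^ n) := Odd.pow (by decide)
      obtain ⟨l, hl⟩ := hodd
      have hl' : (5 : ℝ) ^ n = 2 * l + 1 := by exact_mod_cast hl
      have : (5 : ℝ) ^ (n + m) * (j * π / 5 ^ m) = j * π + (l * j : ℤ) * (2 * π) := by
        rw [pow_add, hl']
        push_cast
        field_simp
        ring
      rw [this, Real.cos_add_int_mul_two_pi]
    have hterm (n : ℕ) : (1 / 2 : ℝ) ^ (n + m) * (Real.cos (5 ^ (n + m) * ((k + 1) * π / 5 ^ m)) -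
        Real.cos (5 ^ (n + m) * (k * π / 5 ^ m))) = (1 / 2) ^ n * ((1 / 2) ^ m * s) := by
      have h := hper n (k + 1)
      push_cast at h
      rw [h, hper n k, pow_add, hs]
      ring
    simp_rw [hterm]
    rw [tsum_mul_right, tsum_geometric_two]
    ring
  -- Lower frequencies are bounded by the Lipschitz estimate for cosine, a geometric sum of ratio `5
  -- / 2`.
  have hhead : |∑ n ∈ Finset.range m, (1 / 2 : ℝ) ^ n * (Real.cos (5 ^ n * ((k + 1) * π / 5 ^ m)) -
      Real.cos (5 ^ n * (k * π / 5 ^ m)))| ≤ 2 * π / 3 * (1 / 2) ^ m := by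
    have hle (n : ℕ) : |(1 / 2 : ℝ) ^ n * (Real.cos (5 ^ n * ((k + 1) * π / 5 ^ m)) -
        Real.cos (5 ^ n * (k * π / 5 ^ m)))| ≤ (5 / 2) ^ n * (π / 5 ^ m) := by
      have h := abs_cos_sub_cos_le (5 ^ n * ((k + 1) * π / 5 ^ m)) (5 ^ n * (k * π / 5 ^ m))
      have he : (5 : ℝ) ^ n * ((k + 1) * π / 5 ^ m) - 5 ^ n * (k * π / 5 ^ m) =
          5 ^ n * (π / 5 ^ m) := by ring
      rw [he, abs_of_nonneg (a := 5 ^ n * (π / 5 ^ m)) (by positivity)] at h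
      rw [abs_mul, abs_of_nonneg (a := (1 / 2 : ℝ) ^ n) (by positivity)]
      calc _ ≤ (1 / 2 : ℝ) ^ n * (5 ^ n * (π / 5 ^ m)) := by gcongr
        _ = _ := by rw [← mul_assoc, ← mul_pow]; norm_num
    refine (Finset.abs_sum_le_sum_abs _ _).trans ((Finset.sum_le_sum fun n _ ↦ hle n).trans ?_)
    rw [← Finset.sum_mul, geom_sum_eq (by norm_num)]
    have h5 : (5 / 2 : ℝ) ^ m = (1 / 2) ^ m * 5 ^ m := by rw [← mul_pow]; norm_num
    have : ((5 / 2 : ℝ) ^ m - 1) / (5 / 2 - 1) * (π / 5 ^ m) ≤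
        (5 / 2 : ℝ) ^ m / (5 / 2 - 1) * (π / 5 ^ m) := by
      gcongr
      linarith
    refine this.trans (le_of_eq ?_)
    rw [h5]
    field_simp
    norm_num
  rw [htail]
  have hta : |2 * (1 / 2 : ℝ) ^ m * s| = 4 * (1 / 2) ^ m := by
    rw [abs_mul, hs2, abs_of_nonneg (by positivity)]
    ring
  have := abs_sub_abs_le_abs_add (2 * (1 / 2 : ℝ) ^ m * s)
    (∑ n ∈ Finset.range m, (1 / 2 : ℝ) ^ n * (Real.cos (5 ^ n * ((k + 1) * π / 5 ^ m)) -
      Real.cos (5 ^ n * (k * π / 5 ^ m))))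
  rw [add_comm]
  linarith

open Filter Topology Real in
/-- **Weierstrass's nowhere differentiable function**. -/
theorem nowhereDifferentiable_tsum_cos :
    NowhereDifferentiable fun x ↦ ∑' n : ℕ, (1 / 2 : ℝ) ^ n * Real.cos (5 ^ n * x) := by
  intro x hx
  set g : ℝ → ℝ := fun x ↦ ∑' n : ℕ, (1 / 2 : ℝ) ^ n * Real.cos (5 ^ n * x) with hg
  -- Differentiability would bound increments between the lattice points around `x` by `O(5 ^
  -- (-m))`, against the lower bound of order `2 ^ (-m)`.
  obtain ⟨C, hC0, hC⟩ := hx.isBigO_sub.exists_pos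
  rw [Asymptotics.isBigOWith_iff, Metric.eventually_nhds_iff] at hC
  obtain ⟨δ, hδ, hC⟩ := hC
  have hpi : 2 * π / 3 < 3 := by linarith [pi_lt_d2]
  have hlim1 : Tendsto (fun m : ℕ ↦ π * (1 / 5 : ℝ) ^ m) atTop (𝓝 0) := by
    simpa using (tendsto_pow_atTop_nhds_zero_of_lt_one (by norm_num : (0 : ℝ) ≤ 1 / 5)
      (by norm_num)).const_mul π
  have hlim2 : Tendsto (fun m : ℕ ↦ 2 * C * π * (2 / 5 : ℝ) ^ m) atTop (𝓝 0) := by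
    simpa using (tendsto_pow_atTop_nhds_zero_of_lt_one (by norm_num : (0 : ℝ) ≤ 2 / 5)
      (by norm_num)).const_mul (2 * C * π)
  obtain ⟨m, hm1, hm2⟩ := ((hlim1.eventually (gt_mem_nhds hδ)).and
    (hlim2.eventually (gt_mem_nhds one_pos))).exists
  have h5 : (0 : ℝ) < 5 ^ m := by positivity
  rw [one_div, inv_pow, ← div_eq_mul_inv] at hm1
  set k : ℤ := ⌊x * 5 ^ m / π⌋ with hk
  have hk1 : k * π / 5 ^ m ≤ x := by
    have := Int.floor_le (x * 5 ^ m / π)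
    rw [le_div_iff₀ pi_pos] at this
    rwa [div_le_iff₀ h5]
  have hk2 : x < (k + 1) * π / 5 ^ m := by
    have := Int.lt_floor_add_one (x * 5 ^ m / π)
    rw [div_lt_iff₀ pi_pos] at this
    rwa [lt_div_iff₀ h5]
  have hgap : (k + 1) * π / 5 ^ m = k * π / 5 ^ m + π / 5 ^ m := by ring
  have hd1 : |k * π / 5 ^ m - x| ≤ π / 5 ^ m := abs_le.2 ⟨by linarith, by linarith⟩
  have hd2 : |(k + 1) * π / 5 ^ m - x| ≤ π / 5 ^ m := abs_le.2 ⟨by linarith, by linarith⟩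
  have h1 := hC (hd1.trans_lt hm1)
  have h2 := hC (hd2.trans_lt hm1)
  rw [norm_eq_abs, norm_eq_abs] at h1 h2
  have h3 := le_abs_tsum_cos_sub m k
  have h4 := abs_sub_le (g ((k + 1) * π / 5 ^ m)) (g x) (g (k * π / 5 ^ m))
  rw [abs_sub_comm (g x)] at h4
  have h6 : (4 - 2 * π / 3) * (1 / 2) ^ m ≤ 2 * C * (π / 5 ^ m) := by
    have := mul_le_mul_of_nonneg_left hd1 hC0.le
    have := mul_le_mul_of_nonneg_left hd2 hC0.le
    linarith
  have h7 : 1 * (1 / 2 : ℝ) ^ m ≤ (4 - 2 * π / 3) * (1 / 2) ^ m := by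
    gcongr
    linarith
  have h8 : 2 * C * (π / 5 ^ m) = 2 * C * π * (2 / 5 : ℝ) ^ m * (1 / 2) ^ m := by
    rw [mul_assoc _ ((2 / 5 : ℝ) ^ m), ← mul_pow]
    rw [show (2 / 5 * (1 / 2) : ℝ) = 5⁻¹ by norm_num, inv_pow]
    ring
  rw [h8] at h6
  exact absurd (le_of_mul_le_mul_right (h7.trans h6) (by positivity)) (not_le.2 hm2)

-- Because `5 ^ n ≡ 1` modulo `4`, a shift by `π / 2` turns every sine term into the matching cosine
-- term.
open Real in
theorem nowhereDifferentiable_tsum_sin :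
    NowhereDifferentiable fun x ↦ ∑' n : ℕ, (1 / 2 : ℝ) ^ n * Real.sin (5 ^ n * x) := by
  intro x hx
  refine nowhereDifferentiable_tsum_cos (x - π / 2) ?_
  have hx' : DifferentiableAt ℝ (fun x ↦ ∑' n : ℕ, (1 / 2 : ℝ) ^ n * Real.sin (5 ^ n * x))
      ((x - π / 2) + π / 2) := by simpa using hx
  have := hx'.comp (x - π / 2) (differentiableAt_id.add_const (π / 2))
  refine this.congr_of_eventuallyEq (.of_forall fun y ↦ tsum_congr fun n ↦ ?_)
  simp only [id]
  obtain ⟨l, hl⟩ : ∃ l : ℕ, 5 ^ n = 4 * l + 1 := by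
    refine ⟨5 ^ n / 4, ?_⟩
    have : 5 ^ n % 4 = 1 := by simp [Nat.pow_mod]
    omega
  have hl' : (5 : ℝ) ^ n = 4 * l + 1 := by exact_mod_cast hl
  rw [mul_add, ← Real.sin_add_pi_div_two, show (5 : ℝ) ^ n * (π / 2) = π / 2 + l * (2 * π) by
    rw [hl']; ring, ← add_assoc, Real.sin_add_nat_mul_two_pi]

/-! ### Density of `conjugateNowhereDifferentiable` -/

/-- A lacunary power series, continuous on the closed unit disc, whose real and imaginary parts have
nowhere differentiable boundary values. -/
noncomputable def lacunarySeries (z : ℂ) : ℂ := ∑' n : ℕ, (1 / 2 : ℂ) ^ n * z ^ 5 ^ n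

lemma norm_lacunarySeries_term_le (n : ℕ) {z : ℂ} (hz : z ∈ closedBall (0 : ℂ) 1) :
    ‖(1 / 2 : ℂ) ^ n * z ^ 5 ^ n‖ ≤ (1 / 2 : ℝ) ^ n := by
  rw [norm_mul, norm_pow, norm_pow]
  simpa using pow_le_one₀ (norm_nonneg z) (mem_closedBall_zero_iff.1 hz)

lemma continuousOn_lacunarySeries : ContinuousOn lacunarySeries (closedBall 0 1) :=
  continuousOn_tsum (fun n ↦ by fun_prop) summable_geometric_two
    fun n _ hz ↦ norm_lacunarySeries_term_le n hz

lemma differentiableOn_lacunarySeries : DifferentiableOn ℂ lacunarySeries (ball 0 1) :=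
  differentiableOn_tsum_of_summable_norm summable_geometric_two (fun n ↦ by fun_prop) isOpen_ball
    fun n _ hz ↦ norm_lacunarySeries_term_le n (ball_subset_closedBall hz)

lemma lacunarySeries_term_exp (n : ℕ) (θ : ℝ) :
    (1 / 2 : ℂ) ^ n * (Circle.exp θ : ℂ) ^ 5 ^ n =
      ((1 / 2 : ℝ) ^ n : ℝ) * (Real.cos (5 ^ n * θ) + Real.sin (5 ^ n * θ) * I) := by
  rw [Circle.coe_exp, ← Complex.exp_nat_mul, ofReal_cos, ofReal_sin, ← Complex.exp_mul_I]
  push_cast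
  ring_nf

lemma summable_lacunarySeries (ζ : Circle) :
    Summable fun n : ℕ ↦ (1 / 2 : ℂ) ^ n * (ζ : ℂ) ^ 5 ^ n :=
  Summable.of_norm_bounded summable_geometric_two
    fun n ↦ norm_lacunarySeries_term_le n ζ.coe_mem_closedBall

lemma re_lacunarySeries_exp (θ : ℝ) : (lacunarySeries (Circle.exp θ)).re =
    ∑' n : ℕ, (1 / 2 : ℝ) ^ n * Real.cos (5 ^ n * θ) := by
  rw [lacunarySeries, re_tsum (summable_lacunarySeries _)]
  refine tsum_congr fun n ↦ ?_
  rw [lacunarySeries_term_exp, re_ofReal_mul, add_re, ofReal_re, re_ofReal_mul, I_re]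
  ring

lemma im_lacunarySeries_exp (θ : ℝ) : (lacunarySeries (Circle.exp θ)).im =
    ∑' n : ℕ, (1 / 2 : ℝ) ^ n * Real.sin (5 ^ n * θ) := by
  rw [lacunarySeries, im_tsum (summable_lacunarySeries _)]
  refine tsum_congr fun n ↦ ?_
  rw [lacunarySeries_term_exp, im_ofReal_mul, add_im, ofReal_im, im_ofReal_mul, I_im]
  ring

/-- The boundary values of the real part of a function continuous on the closed disc. -/
def reBoundary (F : ℂ → ℂ) (hF : ContinuousOn F (closedBall 0 1)) : C(Circle, ℝ) :=
  ⟨fun ζ ↦ (F ζ).re,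
    continuous_re.comp (hF.comp_continuous (by fun_prop) Circle.coe_mem_closedBall)⟩

lemma isHarmonicConjugate_reBoundary {F : ℂ → ℂ} (hF : ContinuousOn F (closedBall 0 1))
    (hd : DifferentiableOn ℂ F (ball 0 1)) :
    IsHarmonicConjugate (reBoundary F hF) fun z ↦ (F z).im :=
  ⟨fun z ↦ (F z).re, ⟨fun z hz ↦ (hd.analyticOnNhd isOpen_ball z hz).harmonicAt_re,
    continuous_re.comp_continuousOn hF, fun _ ↦ rfl⟩,
    hd.congr fun z _ ↦ by rw [mul_comm, re_add_im]⟩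

lemma NowhereDifferentiable.add_const_mul {f g : ℝ → ℝ} (hf : Differentiable ℝ f)
    (hg : NowhereDifferentiable g) {t : ℝ} (ht : t ≠ 0) :
    NowhereDifferentiable fun θ ↦ f θ + t * g θ := by
  intro θ h
  refine hg θ (((h.sub (hf θ)).const_mul t⁻¹).congr_of_eventuallyEq (.of_forall fun x ↦ ?_))
  simp [ht]

lemma differentiable_circleExp : Differentiable ℝ fun θ : ℝ ↦ (Circle.exp θ : ℂ) := by
  simp only [Circle.coe_exp]
  exact Differentiable.cexp (ofRealCLM.differentiable.mul_const I)

/-- Perturbing a function analytic up to the boundary by a multiple of the lacunary series. -/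
lemma reBoundary_add_smul_mem {H : ℂ → ℂ} (hH : AnalyticOnNhd ℂ H (closedBall 0 1)) {t : ℝ}
    (ht : t ≠ 0) :
    reBoundary H hH.continuousOn + t • reBoundary lacunarySeries continuousOn_lacunarySeries ∈
      conjugateNowhereDifferentiable := by
  have hHexp : Differentiable ℝ fun θ : ℝ ↦ H (Circle.exp θ) := fun θ ↦
    ((hH _ (Circle.coe_mem_closedBall _)).differentiableAt.restrictScalars ℝ).comp θ
      (differentiable_circleExp θ)
  refine ⟨?_, _, (isHarmonicConjugate_reBoundary hH.continuousOn
    (hH.differentiableOn.mono ball_subset_closedBall)).add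
    ((isHarmonicConjugate_reBoundary continuousOn_lacunarySeries
      differentiableOn_lacunarySeries).smul t), _, ?_, fun _ _ ↦ rfl, ?_⟩
  · refine NowhereDifferentiable.add_const_mul (f := fun θ ↦ (H (Circle.exp θ)).re)
      (g := fun θ ↦ (lacunarySeries (Circle.exp θ)).re)
      (fun θ ↦ reCLM.differentiableAt.comp θ (hHexp θ)) ?_ ht
    simp only [re_lacunarySeries_exp]
    exact nowhereDifferentiable_tsum_cos
  · exact (continuous_im.comp_continuousOn hH.continuousOn).add
      ((continuous_im.comp_continuousOn continuousOn_lacunarySeries).const_smul t)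
  · refine NowhereDifferentiable.add_const_mul (f := fun θ ↦ (H (Circle.exp θ)).im)
      (g := fun θ ↦ (lacunarySeries (Circle.exp θ)).im)
      (fun θ ↦ imCLM.differentiableAt.comp θ (hHexp θ)) ?_ ht
    simp only [im_lacunarySeries_exp]
    exact nowhereDifferentiable_tsum_sin

/-- Functions analytic up to the boundary have dense real parts on the circle. -/
lemma exists_analyticOnNhd_dist_reBoundary_lt (u : C(Circle, ℝ)) {ε : ℝ} (hε : 0 < ε) :
    ∃ (H : ℂ → ℂ) (hH : AnalyticOnNhd ℂ H (closedBall 0 1)),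
      dist (reBoundary H hH.continuousOn) u < ε := by
  obtain ⟨δ, hδ, hu⟩ := Metric.uniformContinuousOn_iff.1
    ((isCompact_closedBall (0 : ℂ) 1).uniformContinuousOn_of_continuous
      (continuousOn_poissonExtension u)) ε hε
  -- Dilation by `1 - s` carries the closed disc into the open one and moves points by at most `s <
  -- δ`.
  set s : ℝ := min (δ / 2) (1 / 2) with hs
  have hs0 : 0 < s := by positivity
  have hs1 : s ≤ 1 / 2 := min_le_right _ _
  have hsδ : s < δ := (min_le_left _ _).trans_lt (half_lt_self hδ)
  have hmem : ∀ z ∈ closedBall (0 : ℂ) 1, ((1 - s : ℝ) : ℂ) * z ∈ ball (0 : ℂ) 1 := by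
    intro z hz
    rw [mem_closedBall_zero_iff] at hz
    rw [mem_ball_zero_iff, norm_mul, norm_real, Real.norm_of_nonneg (by linarith)]
    nlinarith [norm_nonneg z]
  have hH : AnalyticOnNhd ℂ (fun z ↦ schwarzIntegral u ((1 - s : ℝ) * z)) (closedBall 0 1) :=
    fun z hz ↦ (analyticOnNhd_schwarzIntegral u _ (hmem z hz)).comp_of_eq (by fun_prop) rfl
  refine ⟨_, hH, (ContinuousMap.dist_lt_iff hε).2 fun ζ ↦ ?_⟩
  have hb := hmem ζ ζ.coe_mem_closedBall
  have h := hu _ (ball_subset_closedBall hb) _ ζ.coe_mem_closedBall (by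
    rw [dist_eq_norm, show ((1 - s : ℝ) : ℂ) * ζ - ζ = -((s : ℝ) * ζ) by push_cast; ring, norm_neg,
      norm_mul, Circle.norm_coe, norm_real, Real.norm_of_nonneg hs0.le, mul_one]
    exact hsδ)
  rwa [poissonExtension_of_mem u hb, poissonExtension_coe] at h

lemma dense_conjugateNowhereDifferentiable : Dense conjugateNowhereDifferentiable := by
  refine Metric.dense_iff.2 fun u ε hε ↦ ?_
  obtain ⟨H, hH, hd⟩ := exists_analyticOnNhd_dist_reBoundary_lt u (half_pos hε)
  set u₀ := reBoundary lacunarySeries continuousOn_lacunarySeries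
  -- The `+ 1` avoids having to show `u₀ ≠ 0`.
  have ht : 0 < ε / 2 / (‖u₀‖ + 1) := by positivity
  refine ⟨_, ?_, reBoundary_add_smul_mem hH ht.ne'⟩
  rw [mem_ball]
  refine (dist_triangle _ (reBoundary H hH.continuousOn) _).trans_lt ?_
  have h : dist (reBoundary H hH.continuousOn + (ε / 2 / (‖u₀‖ + 1)) • u₀)
      (reBoundary H hH.continuousOn) ≤ ε / 2 := by
    rw [dist_eq_norm, add_sub_cancel_left, norm_smul, Real.norm_of_nonneg ht.le,
      div_mul_eq_mul_div, div_le_iff₀ (by positivity)]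
    gcongr
    linarith
  linarith

theorem proposition2p6 :
    Dense conjugateNowhereDifferentiable ∧
    IsMeagre conjugateNowhereDifferentiable ∧
    IsGδ conjugateUnbounded ∧
    Dense conjugateUnbounded ∧
    Disjoint conjugateNowhereDifferentiable conjugateUnbounded := by
  have hdense := dense_conjugateUnbounded nonempty_conjugateUnbounded
  have hdisj := disjoint_conjugateNowhereDifferentiable_conjugateUnbounded
  refine ⟨dense_conjugateNowhereDifferentiable, ?_, isGδ_conjugateUnbounded, hdense, hdisj⟩
  exact Filter.mem_of_superset (residual_of_dense_Gδ isGδ_conjugateUnbounded hdense)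
    hdisj.subset_compl_left
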